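/- Let $W_0$, $W_1$ be finite-dimensional real vector spaces, $\langle\cdot,\cdot\rangle$ a nondegenerate symmetric bilinear form on $W_1$, and $\partial : W_1 \to W_0$ a linear map such that the image of $\partial^* : W_0^* \to W_1^* \cong W_1$ is isotropic (equivalently, $W_0^* \xrightarrow{\partial^*} W_1 \xrightarrow{\partial} W_0$ is a chain complex). Let $(V_\bullet,\omega)$ be the corresponding symmetric constant symplectic $2$-groupoid. Here $V_\bullet$ is the simplicial vector space associated with this chain complex, with $$V_0 = W_0,\qquad V_1 = W_1\oplus W_0,\qquad V_2 = W_0^*\oplus W_1\oplus W_1\oplus W_0,$$ face maps $f_0(w_1,w_0)=w_0$, $f_1(w_1,w_0)=w_0-\partial w_1$ on $V_1$, $f_0(w_2,w_1,w_1',w_0)=(w_1,w_0)$, $f_1(w_2,w_1,w_1',w_0)=(w_1',w_0)$, $f_2(w_2,w_1,w_1',w_0)=(\partial^*w_2+w_1'-w_1,\,w_0-\partial w_1)$ on $V_2$, degeneracy maps $\sigma_0(w_0)=(0,w_0)$, $\sigma_0(w_1,w_0)=(0,w_1,w_1,w_0)$, $\sigma_1(w_1,w_0)=(0,0,w_1,w_0)$,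 and higher simplices determined by unique horn filling; and $\omega$ is the constant, normalized, multiplicative $2$-form on $V_2$ whose component pairing $W_0$ with $W_0^*$ is the canonical one and whose component $C_{32}(w,w')=\omega((0,0,w,0),(0,w',0,0))$ on $W_1$ is $\tfrac12\langle\cdot,\cdot\rangle$. Let $E = W_1\times W_0\to W_0$ be the corresponding constant Courant algebroid: its pairing is $\langle\cdot,\cdot\rangle$, its anchor is $\rho(w_1,w_0)=(\partial w_1,w_0)$, and its bracket is $$[\![ f w, g w' ]\!] = f\rho(w)(g)\,w' - g\rho(w')(f)\,w + g\langle w,w'\rangle\,\mathcal D f,\qquad f,g\in C^\infty(W_0),\ w,w'\in W_1,$$ where $\langle \mathcal D f,e\rangle=\rho(e)(f)$. A constant Dirac structure is a subbundle of $E$ of the form $U_1\times W_0$, with $U_1\subseteq W_1$ a subspace, that equals its own orthogonal and whose sections are closed under the bracket. A linear sub-$2$-groupoid $L_\bullet\subseteq V_\bullet$ is a simplicial subspace that is itself a $2$-groupoid (its $(q,k)$-horn maps are surjective for $q\ge1$ and bijective for $q>2$); it is Lagrangian if $L_2$ equals its $\omega$-orthogonal in $V_2$, and wide if $L_0=V_0$.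 Then there is a one-to-one correspondence between constant Dirac structures $U_1\times W_0\subseteq W_1\times W_0$ and wide linear Lagrangian sub-$2$-groupoids $L_\bullet\subseteq V_\bullet$, under which $U_1\times W_0$ corresponds to the $L_\bullet$ with $L_1 = U_1\oplus W_0$ and $L_2 = 0\oplus U_1\oplus U_1\oplus W_0$. -/

import Mathlib

open CategoryTheory Opposite Simplicial


universe u v

noncomputable section

/-! ### Linear 2-groupoids -/

/-- A simplicial real vector space. -/
abbrev SimplicialVect := SimplicialObject (ModuleCat.{u} ℝ)

namespace SimplicialVect

variable (V : SimplicialVect.{u})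

/-- The face map `f_i : V_{n+1} → V_n`. -/
abbrev face {n : ℕ} (i : Fin (n + 2)) : V _⦋n + 1⦌ →ₗ[ℝ] V _⦋n⦌ := (V.δ i).hom

/-- The degeneracy map `σ_i : V_n → V_{n+1}`. -/
abbrev degen {n : ℕ} (i : Fin (n + 1)) : V _⦋n⦌ →ₗ[ℝ] V _⦋n + 1⦌ := (V.σ i).hom

/-- The horn compatibility equations `f_i x_j = f_{j-1} x_i`, `i < j`, for a `(q+1, k)`-horn
`(x_i)_{i ≠ k}` of `q`-simplices. A pair of indices `i < j` is written here as
`i.castSucc < j.succ` with `i ≤ j`. There is no condition on `(1, k)`-horns. -/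
def IsHorn (q : ℕ) (k : Fin (q + 2)) (x : {i : Fin (q + 2) // i ≠ k} → V _⦋q⦌) : Prop :=
  match q, k, x with
  | 0, _, _ => True
  | q + 1, k, x => ∀ (i j : Fin (q + 2)) (hi : i.castSucc ≠ k) (hj : j.succ ≠ k), i ≤ j →
      V.face i (x ⟨j.succ, hj⟩) = V.face j (x ⟨i.castSucc, hi⟩)

/-- A linear 2-groupoid: a simplicial finite-dimensional vector space all of whose horn maps are
surjective, and whose `(m, k)`-horn maps are bijective for `m > 2`. (A linear map between
finite-dimensional spaces is a surjective submersion iff it is surjective, and a diffeomorphism iff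
it is bijective.) -/
structure IsTwoGroupoid : Prop where
  finite : ∀ n, Module.Finite ℝ (V _⦋n⦌)
  fill : ∀ (q : ℕ) (k : Fin (q + 2)) (x : {i : Fin (q + 2) // i ≠ k} → V _⦋q⦌),
    V.IsHorn q k x → ∃ y : V _⦋q + 1⦌, ∀ i, V.face i.1 y = x i
  unique : ∀ (q : ℕ) (k : Fin (q + 2)) (y y' : V _⦋q + 1⦌), 2 < q + 1 →
    (∀ i, i ≠ k → V.face i y = V.face i y') → y = y'

variable {V}

theorem face_face {n : ℕ} {i j : Fin (n + 2)} (h : i ≤ j) (x : V _⦋n + 2⦌) :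
    V.face i (V.face j.succ x) = V.face j (V.face i.castSucc x) := by
  have := congrArg (fun f => f.hom x) (V.δ_comp_δ h)
  simpa using this

theorem face_degen_castSucc {n : ℕ} (i : Fin (n + 1)) (x : V _⦋n⦌) :
    V.face i.castSucc (V.degen i x) = x := by
  have := congrArg (fun f => f.hom x) (V.δ_comp_σ_self (i := i))
  simpa using this

theorem face_degen_succ {n : ℕ} (i : Fin (n + 1)) (x : V _⦋n⦌) :
    V.face i.succ (V.degen i x) = x := by
  have := congrArg (fun f => f.hom x) (V.δ_comp_σ_succ (i := i))
  simpa using this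

theorem face_degen_of_le {n : ℕ} {i : Fin (n + 2)} {j : Fin (n + 1)} (h : i ≤ j.castSucc)
    (x : V _⦋n + 1⦌) : V.face i.castSucc (V.degen j.succ x) = V.degen j (V.face i x) := by
  have := congrArg (fun f => f.hom x) (V.δ_comp_σ_of_le h)
  simpa using this

theorem face_degen_of_gt {n : ℕ} {i : Fin (n + 2)} {j : Fin (n + 1)} (h : j.castSucc < i)
    (x : V _⦋n + 1⦌) : V.face i.succ (V.degen j.castSucc x) = V.degen j (V.face i x) := by
  have := congrArg (fun f => f.hom x) (V.δ_comp_σ_of_gt h)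
  simpa using this

theorem exists_filler_low {q : ℕ} {k : Fin (q + 3)} {x : {i : Fin (q + 3) // i ≠ k} → V _⦋q + 1⦌}
    (hx : V.IsHorn (q + 1) k x) (r : ℕ) (hr : r ≤ k.1) :
    ∃ y : V _⦋q + 2⦌, ∀ i (hi : i ≠ k), i.1 < r → V.face i y = x ⟨i, hi⟩ := by
  induction r with
  | zero => exact ⟨0, fun i _ h => absurd h (by omega)⟩
  | succ r ih =>
    obtain ⟨y, hy⟩ := ih (by omega)
    obtain ⟨s, hs⟩ : ∃ s : Fin (q + 2), s.1 = r := ⟨⟨r, by omega⟩, rfl⟩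
    have hsk : s.castSucc ≠ k := by
      intro h; have := congrArg Fin.val h; simp at this; omega
    refine ⟨y + V.degen s (x ⟨s.castSucc, hsk⟩ - V.face s.castSucc y), ?_⟩
    intro i hi hir
    rw [map_add]
    rcases Nat.lt_succ_iff_lt_or_eq.mp hir with h | h
    · obtain ⟨t, rfl⟩ : ∃ t : Fin (q + 1), s = t.succ :=
        ⟨⟨r - 1, by omega⟩, by ext; simp; omega⟩
      obtain ⟨i, rfl⟩ : ∃ j : Fin (q + 2), i = j.castSucc :=
        ⟨⟨i.1, by omega⟩, by ext; simp⟩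
      have hit : i ≤ t.castSucc := by
        simp at hs h
        rw [Fin.le_def]; simp; omega
      have h1 := hx i t.castSucc hi hsk hit
      have h2 := face_face hit y
      rw [hy _ hi h] at h2 ⊢
      rw [face_degen_of_le hit, map_sub]
      erw [h1, h2]
      simp
    · obtain rfl : i = s.castSucc := by ext; simp [hs, h]
      rw [face_degen_castSucc]; abel

theorem exists_filler_high {q : ℕ} {k : Fin (q + 3)}
    {x : {i : Fin (q + 3) // i ≠ k} → V _⦋q + 1⦌}
    (hx : V.IsHorn (q + 1) k x) (r : ℕ) (hr : r + k.1 ≤ q + 2) :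
    ∃ y : V _⦋q + 2⦌, ∀ i (hi : i ≠ k), (i.1 < k.1 ∨ q + 2 < i.1 + r) →
      V.face i y = x ⟨i, hi⟩ := by
  induction r with
  | zero =>
    obtain ⟨y, hy⟩ := exists_filler_low hx k.1 le_rfl
    exact ⟨y, fun i hi h => hy i hi (by omega)⟩
  | succ r ih =>
    obtain ⟨y, hy⟩ := ih (by omega)
    obtain ⟨s, hs⟩ : ∃ s : Fin (q + 2), s.1 + r = q + 1 := ⟨⟨q + 1 - r, by omega⟩, by simp; omega⟩
    have hsk : s.succ ≠ k := by
      intro h; have := congrArg Fin.val h; simp at this; omega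
    refine ⟨y + V.degen s (x ⟨s.succ, hsk⟩ - V.face s.succ y), ?_⟩
    intro i hi hir
    rw [map_add]
    by_cases his : i = s.succ
    · subst his
      rw [face_degen_succ]; abel
    have hne : i.1 ≠ s.1 + 1 := fun h' => his (by ext; simpa using h')
    rcases hir with h | h
    · obtain ⟨t, rfl⟩ : ∃ t : Fin (q + 1), s = t.succ :=
        ⟨⟨s.1 - 1, by omega⟩, by ext; simp; omega⟩
      obtain ⟨i, rfl⟩ : ∃ j : Fin (q + 2), i = j.castSucc :=
        ⟨⟨i.1, by omega⟩, by ext; simp⟩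
      have hit : i ≤ t.castSucc := by
        simp at hs h
        rw [Fin.le_def]; simp; omega
      have hit' : i ≤ t.succ := hit.trans (Fin.castSucc_lt_succ).le
      have h1 := hx i t.succ hi hsk hit'
      have h2 := face_face hit' y
      rw [hy _ hi (Or.inl h)] at h2 ⊢
      rw [face_degen_of_le hit, map_sub]
      erw [h1, h2]
      simp
    · obtain ⟨t, rfl⟩ : ∃ t : Fin (q + 1), s = t.castSucc :=
        ⟨⟨s.1, by omega⟩, by ext; simp⟩
      obtain ⟨i, rfl⟩ : ∃ j : Fin (q + 2), i = j.succ :=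
        ⟨⟨i.1 - 1, by omega⟩, by ext; simp; omega⟩
      have hlt : t.castSucc < i := by
        simp at hs h hne his
        rw [Fin.lt_def]; simp; omega
      have hit' : t.succ ≤ i := hlt
      have h1 := hx t.succ i hsk hi hit'
      have h2 := face_face hit' y
      have h3 : q + 2 < i.succ.1 + r := by
        simp at hs h hne ⊢; omega
      rw [hy _ hi (Or.inr h3)] at h2 ⊢
      rw [face_degen_of_gt hlt, map_sub]
      erw [← h1, ← h2]
      simp

/-- Every horn in a simplicial vector space has a filler. -/
theorem exists_filler (q : ℕ) (k : Fin (q + 2)) (x : {i : Fin (q + 2) // i ≠ k} → V _⦋q⦌)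
    (hx : V.IsHorn q k x) : ∃ y : V _⦋q + 1⦌, ∀ i, V.face i.1 y = x i := by
  rcases q with _ | q
  · by_cases hk : k = 0
    · subst hk
      refine ⟨V.degen 0 (x ⟨1, by simp⟩), ?_⟩
      rintro ⟨i, hi⟩
      obtain rfl : i = 1 := by revert hi; revert i; decide
      exact face_degen_succ 0 _
    · obtain rfl : k = 1 := (by decide : ∀ k : Fin 2, ¬k = 0 → k = 1) k hk
      refine ⟨V.degen 0 (x ⟨0, by simp⟩), ?_⟩
      rintro ⟨i, hi⟩
      obtain rfl : i = 0 := by revert hi; revert i; decide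
      exact face_degen_castSucc 0 _
  · obtain ⟨y, hy⟩ := exists_filler_high hx (q + 2 - k.1) (by omega)
    refine ⟨y, fun i => hy i.1 i.2 ?_⟩
    have : i.1.1 ≠ k.1 := fun h => i.2 (Fin.ext h)
    omega

/-! ### Constant symplectic 2-groupoids -/

/-- A constant 2-form on `V_2` (an alternating bilinear form) is normalized if its pullbacks along
the degeneracy maps vanish. -/
def IsNormalized (ω : LinearMap.BilinForm ℝ (V _⦋2⦌)) : Prop :=
  ∀ (i : Fin 2) (u v : V _⦋1⦌), ω (V.degen i u) (V.degen i v) = 0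

/-- A constant 2-form on `V_2` is multiplicative if its simplicial coboundary vanishes. -/
def IsMultiplicative (ω : LinearMap.BilinForm ℝ (V _⦋2⦌)) : Prop :=
  ∀ u v : V _⦋3⦌, ∑ i : Fin 4, (-1 : ℝ) ^ (i : ℕ) * ω (V.face i u) (V.face i v) = 0

/-- The pairing of `V_0` with `V_2` induced by `ω`; it descends to the quotient of `V_2` by the
degenerate subspace when `ω` is normalized. -/
def pairingA (ω : LinearMap.BilinForm ℝ (V _⦋2⦌)) (v : V _⦋0⦌) (w : V _⦋2⦌) : ℝ :=
  ω (V.degen 0 (V.degen 0 v)) w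

/-- The symmetric form on `V_1` induced by `ω`; it descends to the quotient of `V_1` by the
degenerate subspace when `ω` is normalized. -/
def pairingB (ω : LinearMap.BilinForm ℝ (V _⦋2⦌)) (θ η : V _⦋1⦌) : ℝ :=
  ω (V.degen 1 θ) (V.degen 0 η) + ω (V.degen 1 η) (V.degen 0 θ)

/-- Simplicial nondegeneracy: the pairings induced on the normalized quotients
`V_0`, `V_1 / σ_0 V_0`, `V_2 / (σ_0 V_1 + σ_1 V_1)` are nondegenerate. -/
structure IsSimpliciallyNondegenerate (ω : LinearMap.BilinForm ℝ (V _⦋2⦌)) : Prop where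
  left : ∀ v, (∀ w, pairingA ω v w = 0) → v = 0
  right : ∀ w, (∀ v, pairingA ω v w = 0) →
    w ∈ LinearMap.range (V.degen (0 : Fin 2)) ⊔ LinearMap.range (V.degen (1 : Fin 2))
  mid : ∀ θ, (∀ η, pairingB ω θ η = 0) → θ ∈ LinearMap.range (V.degen (0 : Fin 1))

end SimplicialVect

/-- A constant symplectic 2-groupoid: a linear 2-groupoid `V` with a constant 2-form on `V_2` that
is multiplicative, normalized and simplicially nondegenerate (a constant form is closed). -/
structure ConstantSymplecticTwoGroupoid where
  V : SimplicialVect.{u}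
  isTwoGroupoid : V.IsTwoGroupoid
  ω : LinearMap.BilinForm ℝ (V _⦋2⦌)
  alt : ω.IsAlt
  multiplicative : SimplicialVect.IsMultiplicative ω
  normalized : SimplicialVect.IsNormalized ω
  nondegenerate : SimplicialVect.IsSimpliciallyNondegenerate ω

/-- The component `C_32 (w, w') = ω ((0,0,w,0), (0,w',0,0))` of `ω` on `ker f_0 ⊆ V_1` is symmetric.
Here `(0,0,w,0) = σ_1 w` and `(0,w',0,0) = σ_0 w' - σ_1 w'`. -/
def ConstantSymplecticTwoGroupoid.IsSymmetric (S : ConstantSymplecticTwoGroupoid.{u}) : Prop :=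
  ∀ w w' : S.V _⦋1⦌, S.V.face 0 w = 0 → S.V.face 0 w' = 0 →
    S.ω (S.V.degen 1 w) (S.V.degen 0 w' - S.V.degen 1 w') =
      S.ω (S.V.degen 1 w') (S.V.degen 0 w - S.V.degen 1 w)

/-! ### Linear sub-2-groupoids -/

/-- A simplicial subspace of a simplicial vector space. -/
@[ext]
structure SimplicialSubspace (V : SimplicialVect.{u}) where
  obj : ∀ n : ℕ, Submodule ℝ (V _⦋n⦌)
  map_mem : ∀ {m n : ℕ} (θ : ⦋m⦌ ⟶ ⦋n⦌) (x : V _⦋n⦌), x ∈ obj n → (V.map θ.op).hom x ∈ obj m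

namespace SimplicialSubspace

variable {V : SimplicialVect.{u}} (L : SimplicialSubspace V)

/-- A simplicial subspace, as a simplicial vector space. -/
def toSimplicialVect : SimplicialVect.{u} where
  obj n := ModuleCat.of ℝ (L.obj n.unop.len)
  map θ := ModuleCat.ofHom ((V.map θ).hom.restrict fun x hx => L.map_mem θ.unop x hx)
  map_id n := by
    ext x
    simp [LinearMap.restrict_apply]
  map_comp f g := by
    ext x
    simp [LinearMap.restrict_apply]

/-- `L` is a linear sub-2-groupoid: a simplicial subspace that is itself a 2-groupoid. -/
def IsSubTwoGroupoid : Prop := L.toSimplicialVect.IsTwoGroupoid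

/-- `L` is wide: `L_0 = V_0`. -/
def IsWide : Prop := L.obj 0 = ⊤

/-- `L` is Lagrangian with respect to `ω`: `L_2` equals its `ω`-orthogonal in `V_2`. -/
def IsLagrangian (ω : LinearMap.BilinForm ℝ (V _⦋2⦌)) : Prop :=
  ∀ x, x ∈ L.obj 2 ↔ ∀ y ∈ L.obj 2, ω x y = 0

end SimplicialSubspace

/-! ### The linear 2-groupoid of a 3-term complex -/

section ThreeTerm

variable {W₀ : Type u} {W₁ : Type v} {W₂ : Type u}
  [AddCommGroup W₀] [Module ℝ W₀] [AddCommGroup W₁] [Module ℝ W₁] [AddCommGroup W₂] [Module ℝ W₂]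
  (d₁ : W₁ →ₗ[ℝ] W₀) (d₂ : W₂ →ₗ[ℝ] W₁)

/-- The space of `n`-simplices of the linear 2-groupoid of the complex `W₂ → W₁ → W₀`. An
`n`-simplex assigns an element `a i` of `W₀` to each vertex, `b i j` of `W₁` to each edge and
`c i j k` of `W₂` to each triangle of the standard `n`-simplex, vanishing on degenerate edges and
triangles (and, to fix the values, on tuples that are not increasing), such that
`∂ b_{ij} = a_j - a_i`, `∂ c_{ijk} = b_{jk} - b_{ik} + b_{ij}` and
`0 = c_{jkl} - c_{ikl} + c_{ijl} - c_{ijk}`. -/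
def simplices (n : ℕ) : Submodule ℝ ((Fin (n + 1) → W₀) × (Fin (n + 1) → Fin (n + 1) → W₁) ×
    (Fin (n + 1) → Fin (n + 1) → Fin (n + 1) → W₂)) where
  carrier := {x |
    (∀ i j, ¬ i < j → x.2.1 i j = 0) ∧
    (∀ i j k, ¬ (i < j ∧ j < k) → x.2.2 i j k = 0) ∧
    (∀ i j, i ≤ j → d₁ (x.2.1 i j) = x.1 j - x.1 i) ∧
    (∀ i j k, i ≤ j → j ≤ k → d₂ (x.2.2 i j k) = x.2.1 j k - x.2.1 i k + x.2.1 i j) ∧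
    (∀ i j k l, i ≤ j → j ≤ k → k ≤ l →
      x.2.2 j k l - x.2.2 i k l + x.2.2 i j l - x.2.2 i j k = 0)}
  zero_mem' := by simp
  add_mem' := by
    rintro x y ⟨h1, h2, h3, h4, h5⟩ ⟨g1, g2, g3, g4, g5⟩
    refine ⟨fun i j h => by simp [h1 i j h, g1 i j h], fun i j k h => by simp [h2 i j k h, g2 i j k h],
      fun i j h => ?_, fun i j k h h' => ?_, fun i j k l h h' h'' => ?_⟩
    · simp only [Prod.fst_add, Prod.snd_add, Pi.add_apply, map_add, h3 i j h, g3 i j h]; abel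
    · simp only [Prod.fst_add, Prod.snd_add, Pi.add_apply, map_add, h4 i j k h h', g4 i j k h h']
      abel
    · have e1 := h5 i j k l h h' h''
      have e2 := g5 i j k l h h' h''
      simp only [Prod.snd_add, Pi.add_apply]
      rw [← add_zero (0 : W₂)]
      nth_rewrite 1 [← e1]
      rw [← e2]; abel
  smul_mem' := by
    rintro r x ⟨h1, h2, h3, h4, h5⟩
    refine ⟨fun i j h => by simp [h1 i j h], fun i j k h => by simp [h2 i j k h],
      fun i j h => ?_, fun i j k h h' => ?_, fun i j k l h h' h'' => ?_⟩
    · simp only [Prod.smul_fst, Prod.smul_snd, Pi.smul_apply, map_smul, h3 i j h, smul_sub]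
    · simp only [Prod.smul_fst, Prod.smul_snd, Pi.smul_apply, map_smul, h4 i j k h h', smul_sub,
        smul_add]
    · simp only [Prod.smul_snd, Pi.smul_apply, ← smul_sub, ← smul_add, h5 i j k l h h' h'',
        smul_zero]

/-- The action of a monotone map `θ : {0,…,m} → {0,…,n}` on simplices, by precomposition. -/
def simplicesMap {m n : ℕ} (θ : Fin (m + 1) →o Fin (n + 1)) :
    simplices d₁ d₂ n →ₗ[ℝ] simplices d₁ d₂ m where
  toFun x := ⟨(fun i => x.1.1 (θ i), fun i j => x.1.2.1 (θ i) (θ j),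
      fun i j k => x.1.2.2 (θ i) (θ j) (θ k)), by
    obtain ⟨x, h1, h2, h3, h4, h5⟩ := x
    exact ⟨fun i j h => h1 _ _ fun h' => h (θ.monotone.reflect_lt h'),
      fun i j k h => h2 _ _ _ fun h' =>
        h ⟨θ.monotone.reflect_lt h'.1, θ.monotone.reflect_lt h'.2⟩,
      fun i j h => h3 _ _ (θ.monotone h),
      fun i j k h h' => h4 _ _ _ (θ.monotone h) (θ.monotone h'),
      fun i j k l h h' h'' => h5 _ _ _ _ (θ.monotone h) (θ.monotone h') (θ.monotone h'')⟩⟩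
  map_add' _ _ := rfl
  map_smul' _ _ := rfl

/-- The linear 2-groupoid of the 3-term complex `W₂ → W₁ → W₀`. -/
def complexSimplicialVect : SimplicialVect.{max u v} where
  obj n := ModuleCat.of ℝ (simplices d₁ d₂ n.unop.len)
  map θ := ModuleCat.ofHom (simplicesMap d₁ d₂ θ.unop.toOrderHom)
  map_id _ := rfl
  map_comp _ _ := rfl

variable {d₁ d₂}

/-- The identification `V_0 = W₀`. -/
def vertexEquiv : simplices d₁ d₂ 0 ≃ₗ[ℝ] W₀ where
  toFun x := x.1.1 0
  map_add' _ _ := rfl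
  map_smul' _ _ := rfl
  invFun w := ⟨(fun _ => w, fun _ _ => 0, fun _ _ _ => 0), by simp [simplices]⟩
  left_inv := by
    rintro ⟨⟨a, b, c⟩, h1, h2, h3, h4, h5⟩
    refine Subtype.ext (Prod.ext ?_ (Prod.ext ?_ ?_))
    · funext i; exact congrArg a (Subsingleton.elim (α := Fin 1) 0 i)
    · funext i j; exact (h1 i j fun h => h.ne (Subsingleton.elim (α := Fin 1) i j)).symm
    · funext i j k; exact (h2 i j k fun h => h.1.ne (Subsingleton.elim (α := Fin 1) i j)).symm
  right_inv _ := rfl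

/-- The identification `V_1 = W₁ ⊕ W₀`: an edge is determined by its `W₁`-label and its last
vertex `f_0`. -/
def edgeEquiv : simplices d₁ d₂ 1 ≃ₗ[ℝ] W₁ × W₀ where
  toFun x := (x.1.2.1 0 1, x.1.1 1)
  map_add' _ _ := rfl
  map_smul' _ _ := rfl
  invFun w := ⟨(![w.2 - d₁ w.1, w.2], ![![0, w.1], ![0, 0]], fun _ _ _ => 0), by
    refine ⟨?_, ?_, ?_, ?_, ?_⟩
    · simp [Fin.forall_fin_two]
    · simp
    · simp [Fin.forall_fin_two]
    · simp [Fin.forall_fin_two]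
    · simp⟩
  left_inv := by
    rintro ⟨⟨a, b, c⟩, h1, h2, h3, h4, h5⟩
    refine Subtype.ext (Prod.ext ?_ (Prod.ext ?_ ?_))
    · funext i
      have := h3 0 1 (by decide)
      fin_cases i <;> simp_all
    · funext i j
      fin_cases i <;> fin_cases j <;> first | rfl | exact (h1 _ _ (by decide)).symm
    · funext i j k
      exact (h2 i j k (by revert i j k; decide)).symm
  right_inv _ := rfl

/-- The identification `V_2 = W₂ ⊕ W₁ ⊕ W₁ ⊕ W₀`: a triangle is determined by its `W₂`-label, the
`W₁`-labels of its faces `f_0` and `f_1`, and its last vertex. -/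
def triangleEquiv (hd : d₁ ∘ₗ d₂ = 0) :
    simplices d₁ d₂ 2 ≃ₗ[ℝ] W₂ × W₁ × W₁ × W₀ where
  toFun x := (x.1.2.2 0 1 2, x.1.2.1 1 2, x.1.2.1 0 2, x.1.1 2)
  map_add' _ _ := rfl
  map_smul' _ _ := rfl
  invFun w := ⟨(![w.2.2.2 - d₁ w.2.2.1, w.2.2.2 - d₁ w.2.1, w.2.2.2],
      ![![0, d₂ w.1 + w.2.2.1 - w.2.1, w.2.2.1], ![0, 0, w.2.1], ![0, 0, 0]],
      fun i j k => if i < j ∧ j < k then w.1 else 0), by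
    refine ⟨?_, ?_, ?_, ?_, ?_⟩
    · intro i j h
      fin_cases i <;> fin_cases j <;> first | rfl | exact absurd (by decide) h
    · intro i j k h
      exact if_neg h
    · have hd' : d₁ (d₂ w.1) = 0 := LinearMap.congr_fun hd w.1
      intro i j h
      fin_cases i <;> fin_cases j <;> first | (exact absurd h (by decide)) | simp [hd']
    · intro i j k h h'
      rcases h.eq_or_lt with rfl | h1
      · fin_cases i <;> fin_cases k <;> first | (exact absurd h' (by decide)) | simp
      rcases h'.eq_or_lt with rfl | h2
      · fin_cases i <;> fin_cases j <;> first | (exact absurd h1 (by decide)) | simp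
      obtain ⟨rfl, rfl, rfl⟩ : i = 0 ∧ j = 1 ∧ k = 2 := by
        clear h h'; revert i j k; decide
      simp
    · intro i j k l h h' h''
      have : i = j ∨ j = k ∨ k = l := by revert i j k l; decide
      rcases this with rfl | rfl | rfl <;> simp⟩
  left_inv := by
    rintro ⟨⟨a, b, c⟩, h1, h2, h3, h4, h5⟩
    refine Subtype.ext (Prod.ext ?_ (Prod.ext ?_ ?_))
    · funext i
      have e1 := h3 0 2 (by decide)
      have e2 := h3 1 2 (by decide)
      fin_cases i <;> simp_all
    · funext i j
      have e1 := h4 0 1 2 (by decide) (by decide)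
      fin_cases i <;> fin_cases j <;> first
        | rfl
        | exact (h1 _ _ (by decide)).symm
        | (change d₂ (c 0 1 2) + b 0 2 - b 1 2 = b 0 1
           rw [show d₂ (c 0 1 2) = _ from e1]
           change b 1 2 - b 0 2 + b 0 1 + b 0 2 - b 1 2 = b 0 1
           abel)
    · funext i j k
      by_cases h : i < j ∧ j < k
      · obtain ⟨rfl, rfl, rfl⟩ : i = 0 ∧ j = 1 ∧ k = 2 := by
          revert i j k; decide
        rfl
      · exact (if_neg h).trans (h2 i j k h).symm
  right_inv _ := rfl

theorem complexSimplicialVect_unique (q : ℕ) (k : Fin (q + 2))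
    (y y' : (complexSimplicialVect d₁ d₂) _⦋q + 1⦌) (hq : 2 < q + 1)
    (h : ∀ i, i ≠ k → (complexSimplicialVect d₁ d₂).face i y =
      (complexSimplicialVect d₁ d₂).face i y') : y = y' := by
  have avoid : ∀ a b c : Fin (q + 2), ∃ i, i ≠ a ∧ i ≠ b ∧ i ≠ c := by
    intro a b c
    by_contra! hc
    have : (Finset.univ : Finset (Fin (q + 2))) ⊆ {a, b, c} := by
      intro i _
      simp only [Finset.mem_insert, Finset.mem_singleton]
      by_contra! h'
      exact h'.2.2 (hc i h'.1 h'.2.1)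
    have := (Finset.card_le_card this).trans Finset.card_le_three
    simp at this
    omega
  have ha : ∀ i, i ≠ k → ∀ m, y.1.1 (Fin.succAbove i m) = y'.1.1 (Fin.succAbove i m) :=
    fun i hi m => congrArg (fun z : simplices d₁ d₂ q => z.1.1 m) (h i hi)
  have hb : ∀ i, i ≠ k → ∀ m n, y.1.2.1 (Fin.succAbove i m) (Fin.succAbove i n) =
      y'.1.2.1 (Fin.succAbove i m) (Fin.succAbove i n) :=
    fun i hi m n => congrArg (fun z : simplices d₁ d₂ q => z.1.2.1 m n) (h i hi)
  have hc : ∀ i, i ≠ k → ∀ m n p,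
      y.1.2.2 (Fin.succAbove i m) (Fin.succAbove i n) (Fin.succAbove i p) =
      y'.1.2.2 (Fin.succAbove i m) (Fin.succAbove i n) (Fin.succAbove i p) :=
    fun i hi m n p => congrArg (fun z : simplices d₁ d₂ q => z.1.2.2 m n p) (h i hi)
  have hc' : ∀ l m n : Fin (q + 2), (∃ i, i ≠ k ∧ i ≠ l ∧ i ≠ m ∧ i ≠ n) →
      y.1.2.2 l m n = y'.1.2.2 l m n := by
    rintro l m n ⟨i, hi, hl, hm, hn⟩
    obtain ⟨l, rfl⟩ := Fin.exists_succAbove_eq hl.symm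
    obtain ⟨m, rfl⟩ := Fin.exists_succAbove_eq hm.symm
    obtain ⟨n, rfl⟩ := Fin.exists_succAbove_eq hn.symm
    exact hc i hi l m n
  have hk1 : ∀ m n : Fin (q + 2), y.1.2.2 k m n = y'.1.2.2 k m n := fun m n => by
    obtain ⟨i, h1, h2, h3⟩ := avoid k m n
    exact hc' _ _ _ ⟨i, h1, h1, h2, h3⟩
  have hk2 : ∀ m n : Fin (q + 2), y.1.2.2 m k n = y'.1.2.2 m k n := fun m n => by
    obtain ⟨i, h1, h2, h3⟩ := avoid k m n
    exact hc' _ _ _ ⟨i, h1, h2, h1, h3⟩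
  have hk3 : ∀ m n : Fin (q + 2), y.1.2.2 m n k = y'.1.2.2 m n k := fun m n => by
    obtain ⟨i, h1, h2, h3⟩ := avoid k m n
    exact hc' _ _ _ ⟨i, h1, h2, h3, h1⟩
  refine Subtype.ext (Prod.ext ?_ (Prod.ext ?_ ?_))
  · funext m
    obtain ⟨i, hi, hm, -⟩ := avoid k m m
    obtain ⟨m, rfl⟩ := Fin.exists_succAbove_eq hm.symm
    exact ha i hi m
  · funext m n
    obtain ⟨i, hi, hm, hn⟩ := avoid k m n
    obtain ⟨m, rfl⟩ := Fin.exists_succAbove_eq hm.symm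
    obtain ⟨n, rfl⟩ := Fin.exists_succAbove_eq hn.symm
    exact hb i hi m n
  · funext (l : Fin (q + 2)) (m : Fin (q + 2)) (n : Fin (q + 2))
    by_cases hlt : l < m ∧ m < n
    · obtain ⟨h1, h2⟩ := hlt
      have c := y.2.2.2.2.2
      have c' := y'.2.2.2.2.2
      rcases le_total k l with g | g
      · have e := c k l m n g h1.le h2.le
        have e' := c' k l m n g h1.le h2.le
        rw [hk1, hk1, hk1] at e
        rw [← e'] at e
        simpa using e
      rcases le_total k m with g' | g'
      · have e := c l k m n g g' h2.le
        have e' := c' l k m n g g' h2.le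
        rw [hk1, hk2, hk2] at e
        rw [← e'] at e
        simpa using e
      rcases le_total k n with g'' | g''
      · have e := c l m k n h1.le g' g''
        have e' := c' l m k n h1.le g' g''
        rw [hk2, hk2, hk3] at e
        rw [← e'] at e
        simpa using e
      · have e := c l m n k h1.le h2.le g''
        have e' := c' l m n k h1.le h2.le g''
        rw [hk3, hk3, hk3] at e
        rw [← e'] at e
        simpa using e
    · exact (y.2.2.1 l m n hlt).trans (y'.2.2.1 l m n hlt).symm

theorem complexSimplicialVect_isTwoGroupoid [FiniteDimensional ℝ W₀] [FiniteDimensional ℝ W₁]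
    [FiniteDimensional ℝ W₂] : (complexSimplicialVect d₁ d₂).IsTwoGroupoid where
  finite n := inferInstanceAs (Module.Finite ℝ (simplices d₁ d₂ n))
  fill := SimplicialVect.exists_filler
  unique := complexSimplicialVect_unique

end ThreeTerm

/-! ### The data `(W₁, W₀, ⟨·,·⟩, ∂)` and the associated symmetric constant symplectic 2-groupoid -/

/-- The data `(W₁, W₀, ⟨·,·⟩, ∂)`: a nondegenerate symmetric bilinear form on `W₁` and a linear map
`∂ : W₁ → W₀` such that the image of `∂^*` in `W₁^* ≅ W₁` is isotropic. -/
structure CourantData (W₀ : Type u) (W₁ : Type v) [AddCommGroup W₀] [Module ℝ W₀]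
    [AddCommGroup W₁] [Module ℝ W₁] [FiniteDimensional ℝ W₁] where
  pairing : LinearMap.BilinForm ℝ W₁
  symm : pairing.IsSymm
  nondegenerate : pairing.Nondegenerate
  bdry : W₁ →ₗ[ℝ] W₀
  isotropic : ∀ ξ η : Module.Dual ℝ W₀,
    pairing ((pairing.toDual nondegenerate).symm (ξ ∘ₗ bdry))
      ((pairing.toDual nondegenerate).symm (η ∘ₗ bdry)) = 0

namespace CourantData

section Groupoid

variable {W₀ : Type u} {W₁ : Type v} [AddCommGroup W₀] [Module ℝ W₀]
  [AddCommGroup W₁] [Module ℝ W₁] [FiniteDimensional ℝ W₁] (D : CourantData W₀ W₁)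

/-- The map `∂^* : W₀^* → W₁^* ≅ W₁`. -/
def bdryStar : Module.Dual ℝ W₀ →ₗ[ℝ] W₁ :=
  (D.pairing.toDual D.nondegenerate).symm.toLinearMap ∘ₗ D.bdry.dualMap

theorem pairing_bdryStar (ξ : Module.Dual ℝ W₀) (w : W₁) :
    D.pairing (D.bdryStar ξ) w = ξ (D.bdry w) := by
  simp [bdryStar]

theorem pairing_bdryStar_right (ξ : Module.Dual ℝ W₀) (w : W₁) :
    D.pairing w (D.bdryStar ξ) = ξ (D.bdry w) := by
  rw [D.symm.eq, pairing_bdryStar]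

theorem bdry_bdryStar (ξ : Module.Dual ℝ W₀) : D.bdry (D.bdryStar ξ) = 0 := by
  rw [← Module.forall_dual_apply_eq_zero_iff ℝ]
  intro η
  rw [← pairing_bdryStar]
  exact D.isotropic η ξ

theorem bdry_comp_bdryStar : D.bdry ∘ₗ D.bdryStar = 0 :=
  LinearMap.ext D.bdry_bdryStar

/-- The linear 2-groupoid `V` of the complex `W₀^* → W₁ → W₀` given by `∂^*` and `∂`. -/
def V : SimplicialVect.{max u v} := complexSimplicialVect D.bdry D.bdryStar

/-- `V_0 = W₀`. -/
def coord₀ : D.V _⦋0⦌ ≃ₗ[ℝ] W₀ := vertexEquiv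

/-- `V_1 = W₁ ⊕ W₀`. -/
def coord₁ : D.V _⦋1⦌ ≃ₗ[ℝ] W₁ × W₀ := edgeEquiv

/-- `V_2 = W₀^* ⊕ W₁ ⊕ W₁ ⊕ W₀`. -/
def coord₂ : D.V _⦋2⦌ ≃ₗ[ℝ] Module.Dual ℝ W₀ × W₁ × W₁ × W₀ :=
  triangleEquiv D.bdry_comp_bdryStar

/-- The bilinear form `C_32 = ½ ⟨·,·⟩` on `W₁`. -/
def C₃₂ : LinearMap.BilinForm ℝ W₁ := (1 / 2 : ℝ) • D.pairing

/-- The constant 2-form on `W₀^* ⊕ W₁ ⊕ W₁ ⊕ W₀`, in block form. The blocks are determined by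
`C_32` and by the canonical pairing `C_41` of `W₀` with `W₀^*`, through
`C_12(w₂,w₁) = C_32(∂w₂,w₁)`, `C_13(w₂,w₁) = C_32(w₁,∂w₂)`, `C_11(w₂,w₂') = -C_32(∂w₂,∂w₂')`,
`C_22 = -C_23 - C_32` and `C_ij(w,w') = -C_ji(w',w)`; the other blocks vanish. -/
def blockForm : LinearMap.BilinForm ℝ (Module.Dual ℝ W₀ × W₁ × W₁ × W₀) :=
  LinearMap.mk₂ ℝ
    (fun x y =>
      let (w₂, w₁, w₁', w₀) := x
      let (u₂, u₁, u₁', u₀) := y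
      (-D.C₃₂ (D.bdryStar w₂) (D.bdryStar u₂) + D.C₃₂ (D.bdryStar w₂) u₁
          + D.C₃₂ u₁' (D.bdryStar w₂) - w₂ u₀)
        + (-D.C₃₂ (D.bdryStar u₂) w₁ + (D.C₃₂ u₁ w₁ - D.C₃₂ w₁ u₁) - D.C₃₂ u₁' w₁)
        + (-D.C₃₂ w₁' (D.bdryStar u₂) + D.C₃₂ w₁' u₁)
        + u₂ w₀)
    (by intros; simp; ring) (by intros; simp; ring) (by intros; simp; ring) (by intros; simp; ring)

/-- The constant 2-form on `V_2`. -/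
def form : LinearMap.BilinForm ℝ (D.V _⦋2⦌) :=
  D.blockForm.compl₁₂ D.coord₂.toLinearMap D.coord₂.toLinearMap

/-- A simplified formula for the 2-form. -/
theorem form_apply (x y : D.V _⦋2⦌) :
    D.form x y = (1 / 2 : ℝ) * ((D.coord₂ x).1 (D.bdry (D.coord₂ y).2.1)
        + (D.coord₂ x).1 (D.bdry (D.coord₂ y).2.2.1)
        - (D.coord₂ y).1 (D.bdry (D.coord₂ x).2.1) - (D.coord₂ y).1 (D.bdry (D.coord₂ x).2.2.1)
        - D.pairing (D.coord₂ x).2.1 (D.coord₂ y).2.2.1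
        + D.pairing (D.coord₂ x).2.2.1 (D.coord₂ y).2.1)
      - (D.coord₂ x).1 (D.coord₂ y).2.2.2 + (D.coord₂ y).1 (D.coord₂ x).2.2.2 := by
  have s := D.symm.eq (D.coord₂ x).2.1 (D.coord₂ y).2.2.1
  have s' := D.symm.eq (D.coord₂ x).2.1 (D.coord₂ y).2.1
  simp only [form, blockForm, C₃₂, LinearMap.compl₁₂_apply, LinearEquiv.coe_coe,
    LinearMap.mk₂_apply, LinearMap.smul_apply, pairing_bdryStar, pairing_bdryStar_right,
    bdry_bdryStar, smul_eq_mul, map_zero]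
  rw [s, s']
  ring

theorem form_alt : D.form.IsAlt := by
  intro x
  have s := D.symm.eq (D.coord₂ x).2.1 (D.coord₂ x).2.2.1
  rw [form_apply, s]
  ring

theorem coord₂_degen_zero (x : D.V _⦋1⦌) :
    D.coord₂ (D.V.degen 0 x) = (0, (D.coord₁ x).1, (D.coord₁ x).1, (D.coord₁ x).2) := by
  refine Prod.ext ?_ rfl
  exact x.2.2.1 _ _ _ (by decide)

theorem coord₂_degen_one (x : D.V _⦋1⦌) :
    D.coord₂ (D.V.degen 1 x) = (0, 0, (D.coord₁ x).1, (D.coord₁ x).2) := by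
  refine Prod.ext ?_ (Prod.ext ?_ rfl)
  · exact x.2.2.1 _ _ _ (by decide)
  · exact x.2.1 _ _ (by decide)

theorem coord₁_degen (x : D.V _⦋0⦌) : D.coord₁ (D.V.degen 0 x) = (0, D.coord₀ x) := by
  refine Prod.ext ?_ rfl
  exact x.2.1 _ _ (by decide)

theorem coord₀_face_zero (x : D.V _⦋1⦌) : D.coord₀ (D.V.face 0 x) = (D.coord₁ x).2 := rfl

theorem coord₀_face_one (x : D.V _⦋1⦌) :
    D.coord₀ (D.V.face 1 x) = (D.coord₁ x).2 - D.bdry (D.coord₁ x).1 := by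
  have := x.2.2.2.1 0 1 (by decide)
  have e : D.bdry (D.coord₁ x).1 = x.1.1 1 - x.1.1 0 := this
  rw [e]
  exact (sub_sub_cancel _ _).symm

theorem coord₁_face_two (x : D.V _⦋2⦌) : D.coord₁ (D.V.face 2 x) =
    (D.bdryStar (D.coord₂ x).1 + (D.coord₂ x).2.2.1 - (D.coord₂ x).2.1,
      (D.coord₂ x).2.2.2 - D.bdry (D.coord₂ x).2.1) := by
  have hb : D.bdryStar (D.coord₂ x).1 = x.1.2.1 1 2 - x.1.2.1 0 2 + x.1.2.1 0 1 :=
    x.2.2.2.2.1 0 1 2 (by decide) (by decide)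
  have ha : D.bdry (D.coord₂ x).2.1 = x.1.1 2 - x.1.1 1 := x.2.2.2.1 1 2 (by decide)
  rw [hb, ha]
  refine Prod.ext ?_ (sub_sub_cancel _ _).symm
  change x.1.2.1 0 1 = x.1.2.1 1 2 - x.1.2.1 0 2 + x.1.2.1 0 1 + x.1.2.1 0 2 - x.1.2.1 1 2
  abel

theorem form_normalized : SimplicialVect.IsNormalized D.form := by
  intro i u v
  have s := D.symm.eq (D.coord₁ u).1 (D.coord₁ v).1
  fin_cases i
  · change D.form (D.V.degen 0 u) (D.V.degen 0 v) = 0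
    rw [form_apply, coord₂_degen_zero, coord₂_degen_zero]
    simp
  · change D.form (D.V.degen 1 u) (D.V.degen 1 v) = 0
    rw [form_apply, coord₂_degen_one, coord₂_degen_one]
    simp

theorem form_nondegenerate : SimplicialVect.IsSimpliciallyNondegenerate D.form where
  left v hv := by
    apply D.coord₀.injective
    rw [map_zero, ← Module.forall_dual_apply_eq_zero_iff ℝ]
    intro ξ
    have := hv (D.coord₂.symm (ξ, 0, 0, 0))
    simp [SimplicialVect.pairingA, form_apply, coord₂_degen_zero, coord₁_degen] at this
    exact this
  right w hw := by
    have h : (D.coord₂ w).1 = 0 := by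
      ext v
      have := hw (D.coord₀.symm v)
      simpa [SimplicialVect.pairingA, form_apply, coord₂_degen_zero, coord₁_degen] using this
    rw [Submodule.mem_sup]
    refine ⟨_, ⟨D.coord₁.symm ((D.coord₂ w).2.1, 0), rfl⟩, _,
      ⟨D.coord₁.symm ((D.coord₂ w).2.2.1 - (D.coord₂ w).2.1, (D.coord₂ w).2.2.2), rfl⟩, ?_⟩
    apply D.coord₂.injective
    rw [map_add, coord₂_degen_zero, coord₂_degen_one]
    refine Prod.ext ?_ ?_
    · simp [h]
    · simp
  mid θ hθ := by
    have h : (D.coord₁ θ).1 = 0 := by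
      apply D.nondegenerate.1
      intro w
      have s := D.symm.eq w (D.coord₁ θ).1
      have := hθ (D.coord₁.symm (w, 0))
      simp [SimplicialVect.pairingB, form_apply, coord₂_degen_zero, coord₂_degen_one] at this s
      linarith
    refine ⟨D.coord₀.symm (D.coord₁ θ).2, ?_⟩
    apply D.coord₁.injective
    rw [coord₁_degen]
    simp [← h]

/-- The pairing of `V_0` with `V_2` is the canonical pairing of `W₀` with `W₀^*`. -/
theorem pairingA_form (v : D.V _⦋0⦌) (w : D.V _⦋2⦌) :
    SimplicialVect.pairingA D.form v w = (D.coord₂ w).1 (D.coord₀ v) := by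
  simp [SimplicialVect.pairingA, form_apply, coord₂_degen_zero, coord₁_degen]

/-- The symmetric form induced on `V_1` is the pairing of `W₁`. -/
theorem pairingB_form (θ η : D.V _⦋1⦌) :
    SimplicialVect.pairingB D.form θ η = D.pairing (D.coord₁ θ).1 (D.coord₁ η).1 := by
  have s := D.symm.eq (D.coord₁ η).1 (D.coord₁ θ).1
  simp [SimplicialVect.pairingB, form_apply, coord₂_degen_zero, coord₂_degen_one] at s ⊢
  rw [s]
  ring

theorem form_multiplicative : SimplicialVect.IsMultiplicative D.form := by
  intro u v
  have hc : ∀ x : D.V _⦋3⦌, x.1.2.2 0 1 2 = x.1.2.2 1 2 3 - x.1.2.2 0 2 3 + x.1.2.2 0 1 3 :=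
    fun x => (sub_eq_zero.mp (x.2.2.2.2.2 0 1 2 3 (by decide) (by decide) (by decide))).symm
  have hb : ∀ (x : D.V _⦋3⦌) (i : Fin 4), i ≤ 2 →
      x.1.2.1 i 2 = D.bdryStar (x.1.2.2 i 2 3) - x.1.2.1 2 3 + x.1.2.1 i 3 := by
    intro x i hi
    have : D.bdryStar (x.1.2.2 i 2 3) = x.1.2.1 2 3 - x.1.2.1 i 3 + x.1.2.1 i 2 :=
      x.2.2.2.2.1 i 2 3 hi (by decide)
    rw [this]; abel
  have ha : ∀ x : D.V _⦋3⦌, x.1.1 2 = x.1.1 3 - D.bdry (x.1.2.1 2 3) := by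
    intro x
    have : D.bdry (x.1.2.1 2 3) = x.1.1 3 - x.1.1 2 := x.2.2.2.1 2 3 (by decide)
    rw [this]; abel
  have f0 : ∀ x : D.V _⦋3⦌, D.coord₂ (D.V.face 0 x) =
      (x.1.2.2 1 2 3, x.1.2.1 2 3, x.1.2.1 1 3, x.1.1 3) := fun _ => rfl
  have f1 : ∀ x : D.V _⦋3⦌, D.coord₂ (D.V.face 1 x) =
      (x.1.2.2 0 2 3, x.1.2.1 2 3, x.1.2.1 0 3, x.1.1 3) := fun _ => rfl
  have f2 : ∀ x : D.V _⦋3⦌, D.coord₂ (D.V.face 2 x) =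
      (x.1.2.2 0 1 3, x.1.2.1 1 3, x.1.2.1 0 3, x.1.1 3) := fun _ => rfl
  have f3 : ∀ x : D.V _⦋3⦌, D.coord₂ (D.V.face 3 x) =
      (x.1.2.2 0 1 2, x.1.2.1 1 2, x.1.2.1 0 2, x.1.1 2) := fun _ => rfl
  rw [Fin.sum_univ_four]
  rw [form_apply, form_apply, form_apply, form_apply, f0, f0, f1, f1, f2, f2, f3, f3]
  dsimp only
  rw [hc u, hc v, hb u 1 (by decide), hb u 0 (by decide), hb v 1 (by decide), hb v 0 (by decide),
    ha u, ha v]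
  have s := D.symm.eq (u.1.2.1 2 3) (v.1.2.1 2 3)
  simp only [map_add, map_sub, LinearMap.add_apply, LinearMap.sub_apply, pairing_bdryStar,
    pairing_bdryStar_right, bdry_bdryStar, map_zero]
  simp
  rw [s]
  ring

/-- The symmetric constant symplectic 2-groupoid corresponding to `(W₁, W₀, ⟨·,·⟩, ∂)`. -/
def symplecticTwoGroupoid [FiniteDimensional ℝ W₀] : ConstantSymplecticTwoGroupoid.{max u v} where
  V := D.V
  isTwoGroupoid := complexSimplicialVect_isTwoGroupoid
  ω := D.form
  alt := D.form_alt
  multiplicative := D.form_multiplicative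
  normalized := D.form_normalized
  nondegenerate := D.form_nondegenerate

theorem symplecticTwoGroupoid_isSymmetric [FiniteDimensional ℝ W₀] :
    D.symplecticTwoGroupoid.IsSymmetric := by
  intro (w : D.V _⦋1⦌) (w' : D.V _⦋1⦌) _ _
  have s := D.symm.eq (D.coord₁ w).1 (D.coord₁ w').1
  change D.form (D.V.degen 1 w) (D.V.degen 0 w' - D.V.degen 1 w') =
    D.form (D.V.degen 1 w') (D.V.degen 0 w - D.V.degen 1 w)
  rw [map_sub, map_sub, D.form_normalized 1, D.form_normalized 1, form_apply, form_apply,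
    coord₂_degen_zero, coord₂_degen_zero, coord₂_degen_one, coord₂_degen_one]
  simp [s]

end Groupoid

end CourantData

/-! ### Constant Courant algebroids -/

/-- Smooth sections of the trivial bundle `E × M → M` over a vector space `M`, i.e. smooth maps
`M → E`. -/
def smoothSections (M : Type u) (E : Type v) [NormedAddCommGroup M] [NormedSpace ℝ M]
    [NormedAddCommGroup E] [NormedSpace ℝ E] : Submodule ℝ (M → E) where
  carrier := {e | ContDiff ℝ (⊤ : ℕ∞) e}
  add_mem' {e e'} (h : ContDiff ℝ (⊤ : ℕ∞) e) (h' : ContDiff ℝ (⊤ : ℕ∞) e') := by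
    change ContDiff ℝ (⊤ : ℕ∞) fun x => e x + e' x
    exact h.add h'
  zero_mem' := by
    change ContDiff ℝ (⊤ : ℕ∞) fun _ : M => (0 : E)
    exact contDiff_const
  smul_mem' c {e} (h : ContDiff ℝ (⊤ : ℕ∞) e) := by
    change ContDiff ℝ (⊤ : ℕ∞) fun x => c • e x
    exact h.const_smul c

section Courant

variable {W₀ : Type u} {W₁ : Type v} [NormedAddCommGroup W₀] [NormedSpace ℝ W₀]
  [NormedAddCommGroup W₁] [NormedSpace ℝ W₁]

theorem contDiff_section (e : smoothSections W₀ W₁) : ContDiff ℝ (⊤ : ℕ∞) e.1 := e.2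

/-- The product `f e` of a smooth function with a smooth section. -/
def smoothSections.mulFun (f : smoothSections W₀ ℝ) (e : smoothSections W₀ W₁) :
    smoothSections W₀ W₁ :=
  ⟨fun x => f.1 x • e.1 x, by
    change ContDiff ℝ (⊤ : ℕ∞) fun x => f.1 x • e.1 x
    exact (contDiff_section f).smul (contDiff_section e)⟩

/-- The constant section with value `w`. -/
def smoothSections.const (w : W₁) : smoothSections W₀ W₁ := ⟨fun _ => w, by
  change ContDiff ℝ (⊤ : ℕ∞) fun _ : W₀ => w
  exact contDiff_const⟩

variable (W₀ W₁) in
/-- A constant Courant algebroid `W₁ × W₀ → W₀`. The pairing `⟨·,·⟩` and the anchor `ρ` do not depend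
on the base point, so they are a bilinear form on `W₁` and a linear map `W₁ → W₀`. The derivative
`ρ(e)(f)` at `x` is `fderiv ℝ f x (anchor (e x))`. -/
structure ConstantCourantAlgebroid where
  pairing : LinearMap.BilinForm ℝ W₁
  symm : pairing.IsSymm
  nondegenerate : pairing.Nondegenerate
  anchor : W₁ →ₗ[ℝ] W₀
  /-- The Courant bracket on sections. -/
  bracket : smoothSections W₀ W₁ →ₗ[ℝ] smoothSections W₀ W₁ →ₗ[ℝ] smoothSections W₀ W₁
  /-- `⟦e₁, f e₂⟧ = ρ(e₁)(f) e₂ + f ⟦e₁, e₂⟧` -/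
  leibniz : ∀ (e₁ e₂ : smoothSections W₀ W₁) (f : smoothSections W₀ ℝ) (x : W₀),
    (bracket e₁ (smoothSections.mulFun f e₂)).1 x =
      fderiv ℝ f.1 x (anchor (e₁.1 x)) • e₂.1 x + f.1 x • (bracket e₁ e₂).1 x
  /-- `ρ(e₁)⟨e₂, e₃⟩ = ⟨⟦e₁, e₂⟧, e₃⟩ + ⟨e₂, ⟦e₁, e₃⟧⟩` -/
  invariance : ∀ (e₁ e₂ e₃ : smoothSections W₀ W₁) (x : W₀),
    fderiv ℝ (fun y => pairing (e₂.1 y) (e₃.1 y)) x (anchor (e₁.1 x)) =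
      pairing ((bracket e₁ e₂).1 x) (e₃.1 x) + pairing (e₂.1 x) ((bracket e₁ e₃).1 x)
  /-- `⟦⟦e₁, e₂⟧, e₃⟧ = ⟦e₁, ⟦e₂, e₃⟧⟧ - ⟦e₂, ⟦e₁, e₃⟧⟧` -/
  jacobi : ∀ e₁ e₂ e₃ : smoothSections W₀ W₁,
    bracket (bracket e₁ e₂) e₃ = bracket e₁ (bracket e₂ e₃) - bracket e₂ (bracket e₁ e₃)
  /-- `⟦e₁, e₂⟧ + ⟦e₂, e₁⟧ = 𝒟⟨e₁, e₂⟩`, where `𝒟 f` is defined by `⟨𝒟 f, e⟩ = ρ(e)(f)` -/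
  symmetrization : ∀ (e₁ e₂ e₃ : smoothSections W₀ W₁) (x : W₀),
    pairing ((bracket e₁ e₂ + bracket e₂ e₁).1 x) (e₃.1 x) =
      fderiv ℝ (fun y => pairing (e₁.1 y) (e₂.1 y)) x (anchor (e₃.1 x))
  /-- The bracket of constant sections vanishes. -/
  bracket_const : ∀ w w' : W₁,
    bracket (smoothSections.const w) (smoothSections.const w') = 0

/-- A family of subspaces `D_x ⊆ W₁`, `x ∈ W₀`, is a smooth subbundle of `W₁ × W₀` if it has a smooth
frame near every point. -/
def IsSmoothSubbundle (D : W₀ → Submodule ℝ W₁) : Prop :=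
  ∀ x : W₀, ∃ N : Set W₀, IsOpen N ∧ x ∈ N ∧ ∃ (r : ℕ) (s : Fin r → W₀ → W₁),
    (∀ i, ContDiffOn ℝ (⊤ : ℕ∞) (s i) N) ∧
    ∀ y ∈ N, LinearIndependent ℝ (fun i => s i y) ∧
      Submodule.span ℝ (Set.range fun i => s i y) = D y

/-- A Dirac structure: a subbundle `D` with `D^⊥ = D` whose sections are closed under the Courant
bracket. -/
structure ConstantCourantAlgebroid.IsDirac (E : ConstantCourantAlgebroid W₀ W₁)
    (D : W₀ → Submodule ℝ W₁) : Prop where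
  subbundle : IsSmoothSubbundle D
  orthogonal : ∀ x w, w ∈ D x ↔ ∀ u ∈ D x, E.pairing u w = 0
  involutive : ∀ e₁ e₂ : smoothSections W₀ W₁, (∀ x, e₁.1 x ∈ D x) → (∀ x, e₂.1 x ∈ D x) →
    ∀ x, (E.bracket e₁ e₂).1 x ∈ D x

/-- A constant Dirac structure `U × W₀`, given by a subspace `U` of `W₁`. -/
def ConstantCourantAlgebroid.IsConstantDirac (E : ConstantCourantAlgebroid W₀ W₁)
    (U : Submodule ℝ W₁) : Prop :=
  E.IsDirac fun _ => U

namespace CourantData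

variable [FiniteDimensional ℝ W₀] [FiniteDimensional ℝ W₁] (D : CourantData W₀ W₁)

/-- The bilinear operation `(A, b) ↦ ∂^*⟨A ·, b⟩` for `A : W₀ → W₁` linear and `b ∈ W₁`. -/
def starPairing : (W₀ →L[ℝ] W₁) →ₗ[ℝ] W₁ →ₗ[ℝ] W₁ :=
  LinearMap.mk₂ ℝ (fun A b => D.bdryStar (D.pairing.flip b ∘ₗ A.toLinearMap))
    (by intros; rw [← map_add]; congr 1; ext; simp)
    (by intros; rw [← map_smul]; congr 1; ext; simp)
    (by intros; rw [← map_add]; congr 1; ext; simp)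
    (by intros; rw [← map_smul]; congr 1; ext; simp)

theorem pairing_starPairing (A : W₀ →L[ℝ] W₁) (b w : W₁) :
    D.pairing (D.starPairing A b) w = D.pairing (A (D.bdry w)) b := by
  simp [starPairing, pairing_bdryStar]

theorem bdry_starPairing (A : W₀ →L[ℝ] W₁) (b : W₁) : D.bdry (D.starPairing A b) = 0 := by
  simp [starPairing, bdry_bdryStar]

/-- The Courant bracket of two sections. Writing `∇` for the derivative of maps `W₀ → W₁`, it is
`⟦e₁, e₂⟧ = ∇_{∂e₁} e₂ - ∇_{∂e₂} e₁ + ∂^*⟨∇e₁, e₂⟩`; on sections of the form `f w`, `g w'` with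
functions `f, g` and constants `w, w'` this reads
`⟦f w, g w'⟧ = f ρ(w)(g) w' - g ρ(w')(f) w + g ⟨w, w'⟩ 𝒟 f`, where `𝒟 f = ∂^* df`. -/
def bracketFun (e₁ e₂ : W₀ → W₁) (x : W₀) : W₁ :=
  fderiv ℝ e₂ x (D.bdry (e₁ x)) - fderiv ℝ e₁ x (D.bdry (e₂ x)) +
    D.starPairing (fderiv ℝ e₁ x) (e₂ x)

theorem contDiff_bracketFun (e₁ e₂ : smoothSections W₀ W₁) :
    ContDiff ℝ (⊤ : ℕ∞) (D.bracketFun e₁.1 e₂.1) := by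
  have h : ∀ e : smoothSections W₀ W₁, ContDiff ℝ (⊤ : ℕ∞) (fderiv ℝ e.1) := fun e =>
    (contDiff_section e).fderiv_right le_rfl
  have h' : ∀ e : smoothSections W₀ W₁, ContDiff ℝ (⊤ : ℕ∞) fun x => D.bdry (e.1 x) := fun e =>
    D.bdry.toContinuousLinearMap.contDiff.comp (contDiff_section e)
  refine (((h e₂).clm_apply (h' e₁)).sub ((h e₁).clm_apply (h' e₂))).add ?_
  exact (D.starPairing.toContinuousBilinearMap.contDiff.comp (h e₁)).clm_apply (contDiff_section e₂)

theorem differentiable_section (e : smoothSections W₀ W₁) : Differentiable ℝ e.1 :=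
  (contDiff_section e).differentiable (by simp)

theorem fderiv_bracketFun (e₁ e₂ : smoothSections W₀ W₁) (x v : W₀) :
    fderiv ℝ (D.bracketFun e₁.1 e₂.1) x v =
      fderiv ℝ (fderiv ℝ e₂.1) x v (D.bdry (e₁.1 x))
        + fderiv ℝ e₂.1 x (D.bdry (fderiv ℝ e₁.1 x v))
        - fderiv ℝ (fderiv ℝ e₁.1) x v (D.bdry (e₂.1 x))
        - fderiv ℝ e₁.1 x (D.bdry (fderiv ℝ e₂.1 x v))
        + D.starPairing (fderiv ℝ (fderiv ℝ e₁.1) x v) (e₂.1 x)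
        + D.starPairing (fderiv ℝ e₁.1 x) (fderiv ℝ e₂.1 x v) := by
  have h : ∀ e : smoothSections W₀ W₁, HasFDerivAt e.1 (fderiv ℝ e.1 x) x := fun e =>
    (differentiable_section e x).hasFDerivAt
  have h' : ∀ e : smoothSections W₀ W₁,
      HasFDerivAt (fderiv ℝ e.1) (fderiv ℝ (fderiv ℝ e.1) x) x := fun e =>
    ((((contDiff_section e).fderiv_right (m := (⊤ : ℕ∞)) le_rfl).differentiable (by simp)) x).hasFDerivAt
  have hb : ∀ e : smoothSections W₀ W₁, HasFDerivAt (fun y => D.bdry (e.1 y))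
      (D.bdry.toContinuousLinearMap.comp (fderiv ℝ e.1 x)) x := fun e =>
    D.bdry.toContinuousLinearMap.hasFDerivAt.comp x (h e)
  have hs := ((D.starPairing.toContinuousBilinearMap.hasFDerivAt.comp x (h' e₁))).clm_apply (h e₂)
  have H := (((h' e₂).clm_apply (hb e₁)).sub ((h' e₁).clm_apply (hb e₂))).add hs
  have H' : HasFDerivAt (D.bracketFun e₁.1 e₂.1) _ x := H
  rw [H'.fderiv]
  simp
  abel

theorem fderiv_pairing (e₁ e₂ : smoothSections W₀ W₁) (x v : W₀) :
    fderiv ℝ (fun y => D.pairing (e₁.1 y) (e₂.1 y)) x v =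
      D.pairing (fderiv ℝ e₁.1 x v) (e₂.1 x) + D.pairing (e₁.1 x) (fderiv ℝ e₂.1 x v) := by
  have h : ∀ e : smoothSections W₀ W₁, HasFDerivAt e.1 (fderiv ℝ e.1 x) x := fun e =>
    (differentiable_section e x).hasFDerivAt
  have H := (D.pairing.toContinuousBilinearMap.hasFDerivAt.comp x (h e₁)).clm_apply (h e₂)
  have H' : HasFDerivAt (fun y => D.pairing (e₁.1 y) (e₂.1 y)) _ x := H
  rw [H'.fderiv]
  simp
  abel

theorem fderiv_fderiv_symm (e : smoothSections W₀ W₁) (x u v : W₀) :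
    fderiv ℝ (fderiv ℝ e.1) x u v = fderiv ℝ (fderiv ℝ e.1) x v u :=
  ((contDiff_section e).contDiffAt.isSymmSndFDerivAt (by
    rw [minSmoothness_of_isRCLikeNormedField]
    exact WithTop.coe_le_coe.2 le_top)).eq u v

theorem ext_pairing {w w' : W₁} (h : ∀ u, D.pairing w u = D.pairing w' u) : w = w' := by
  rw [← sub_eq_zero]
  apply D.nondegenerate.1
  intro u
  simp [h u]

theorem bracketFun_mulFun_const (f g : smoothSections W₀ ℝ) (w w' : W₁) (x : W₀) :
    D.bracketFun (smoothSections.mulFun f (smoothSections.const w)).1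
      (smoothSections.mulFun g (smoothSections.const w')).1 x =
      (f.1 x * fderiv ℝ g.1 x (D.bdry w)) • w' - (g.1 x * fderiv ℝ f.1 x (D.bdry w')) • w +
        (g.1 x * D.pairing w w') • D.bdryStar (fderiv ℝ f.1 x).toLinearMap := by
  have h : ∀ (e : smoothSections W₀ ℝ) (u : W₁),
      fderiv ℝ (fun y => e.1 y • u) x = (fderiv ℝ e.1 x).smulRight u := fun e u =>
    (((contDiff_section e).differentiable (by simp) x).hasFDerivAt.smul_const u).fderiv
  apply D.ext_pairing
  intro u
  simp only [bracketFun, smoothSections.mulFun, smoothSections.const, h, map_add, map_sub, map_smul,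
    LinearMap.add_apply, LinearMap.sub_apply, LinearMap.smul_apply, pairing_starPairing,
    pairing_bdryStar, ContinuousLinearMap.smulRight_apply, smul_eq_mul, ContinuousLinearMap.coe_coe]
  ring

/-- The constant Courant algebroid `W₁ × W₀ → W₀` corresponding to `(W₁, W₀, ⟨·,·⟩, ∂)`. -/
def courantAlgebroid : ConstantCourantAlgebroid W₀ W₁ where
  pairing := D.pairing
  symm := D.symm
  nondegenerate := D.nondegenerate
  anchor := D.bdry
  bracket := LinearMap.mk₂ ℝ (fun e₁ e₂ => ⟨D.bracketFun e₁.1 e₂.1, D.contDiff_bracketFun e₁ e₂⟩)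
    (by
      intro e₁ e₂ e₃
      apply Subtype.ext
      funext x
      have : fderiv ℝ (e₁.1 + e₂.1) x = fderiv ℝ e₁.1 x + fderiv ℝ e₂.1 x :=
        fderiv_add (differentiable_section e₁ x) (differentiable_section e₂ x)
      simp [bracketFun, this]
      abel)
    (by
      intro c e₁ e₂
      apply Subtype.ext
      funext x
      have : fderiv ℝ (c • e₁.1) x = c • fderiv ℝ e₁.1 x :=
        fderiv_const_smul (differentiable_section e₁ x) c
      simp [bracketFun, this, smul_add, smul_sub])
    (by
      intro e₁ e₂ e₃
      apply Subtype.ext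
      funext x
      have : fderiv ℝ (e₂.1 + e₃.1) x = fderiv ℝ e₂.1 x + fderiv ℝ e₃.1 x :=
        fderiv_add (differentiable_section e₂ x) (differentiable_section e₃ x)
      simp [bracketFun, this]
      abel)
    (by
      intro c e₁ e₂
      apply Subtype.ext
      funext x
      have : fderiv ℝ (c • e₂.1) x = c • fderiv ℝ e₂.1 x :=
        fderiv_const_smul (differentiable_section e₂ x) c
      simp [bracketFun, this, smul_add, smul_sub])
  leibniz := by
    intro e₁ e₂ f x
    have hf : DifferentiableAt ℝ f.1 x := differentiable_section f x
    have : fderiv ℝ (fun y => f.1 y • e₂.1 y) x = _ :=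
      (hf.hasFDerivAt.smul (differentiable_section e₂ x).hasFDerivAt).fderiv
    simp [bracketFun, smoothSections.mulFun, this, smul_add, smul_sub]
    abel
  invariance := by
    intro e₁ e₂ e₃ x
    rw [fderiv_pairing]
    have s1 := D.symm.eq (e₂.1 x) (D.starPairing (fderiv ℝ e₁.1 x) (e₃.1 x))
    have s2 := D.symm.eq (e₂.1 x) (fderiv ℝ e₁.1 x (D.bdry (e₃.1 x)))
    simp [bracketFun, pairing_starPairing] at s1 s2 ⊢
    linarith
  jacobi := by
    intro e₁ e₂ e₃
    apply Subtype.ext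
    funext x
    apply D.ext_pairing
    intro w
    have hsym : ∀ u v, D.pairing u v = D.pairing v u := fun u v => D.symm.eq u v
    have hS : ∀ (A : W₀ →L[ℝ] W₁) (b u : W₁),
        D.pairing u (D.starPairing A b) = D.pairing (A (D.bdry u)) b := fun A b u => by
      rw [hsym, pairing_starPairing]
    have F12 := D.fderiv_bracketFun e₁ e₂ x
    have F23 := D.fderiv_bracketFun e₂ e₃ x
    have F13 := D.fderiv_bracketFun e₁ e₃ x
    have G : ∀ e e' : smoothSections W₀ W₁, D.bdry (D.bracketFun e.1 e'.1 x) =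
        D.bdry (fderiv ℝ e'.1 x (D.bdry (e.1 x))) - D.bdry (fderiv ℝ e.1 x (D.bdry (e'.1 x))) := by
      intro e e'
      simp [bracketFun, bdry_starPairing]
    change D.pairing (D.bracketFun (D.bracketFun e₁.1 e₂.1) e₃.1 x) w =
      D.pairing (D.bracketFun e₁.1 (D.bracketFun e₂.1 e₃.1) x -
        D.bracketFun e₂.1 (D.bracketFun e₁.1 e₃.1) x) w
    have B1 : ∀ (e : W₀ → W₁) (e' : smoothSections W₀ W₁), D.bracketFun e e'.1 x =
        fderiv ℝ e'.1 x (D.bdry (e x)) - fderiv ℝ e x (D.bdry (e'.1 x)) +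
          D.starPairing (fderiv ℝ e x) (e'.1 x) := fun _ _ => rfl
    have B2 : ∀ (e : smoothSections W₀ W₁) (e' : W₀ → W₁), D.bracketFun e.1 e' x =
        fderiv ℝ e' x (D.bdry (e.1 x)) - fderiv ℝ e.1 x (D.bdry (e' x)) +
          D.starPairing (fderiv ℝ e.1 x) (e' x) := fun _ _ => rfl
    rw [B1 _ e₃, B2 e₁ (D.bracketFun e₂.1 e₃.1), B2 e₂ (D.bracketFun e₁.1 e₃.1), G, G, G,
      F12, F23, F13]
    simp only [map_add, map_sub, LinearMap.add_apply, LinearMap.sub_apply, pairing_starPairing, F12]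
    rw [B1 _ e₃, B1 _ e₃]
    simp only [map_add, map_sub, hS]
    rw [fderiv_fderiv_symm e₁ x (D.bdry (e₃.1 x)) (D.bdry (e₂.1 x)),
      fderiv_fderiv_symm e₂ x (D.bdry (e₃.1 x)) (D.bdry (e₁.1 x)),
      fderiv_fderiv_symm e₃ x (D.bdry (e₂.1 x)) (D.bdry (e₁.1 x)),
      fderiv_fderiv_symm e₂ x (D.bdry (e₁.1 x)) (D.bdry w),
      fderiv_fderiv_symm e₁ x (D.bdry (e₂.1 x)) (D.bdry w),
      fderiv_fderiv_symm e₁ x (D.bdry (e₃.1 x)) (D.bdry w)]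
    rw [hsym (fderiv ℝ e₂.1 x (D.bdry w)) (fderiv ℝ e₁.1 x (D.bdry (e₃.1 x)))]
    ring
  symmetrization := by
    intro e₁ e₂ e₃ x
    rw [fderiv_pairing]
    have s := D.symm.eq (e₁.1 x) (fderiv ℝ e₂.1 x (D.bdry (e₃.1 x)))
    simp [bracketFun, pairing_starPairing] at s ⊢
    linarith
  bracket_const := by
    intro w w'
    apply Subtype.ext
    funext x
    simp [bracketFun, smoothSections.const]

end CourantData

end Courant

end

/-!
A simplicial subspace of a linear 2-groupoid fills its own horns, so unique filling determines it by
its 2-simplices. Pairing with the constant triangles, all of which lie in a wide `L`, shows that an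
isotropic `L_2` has vanishing `W₀^*`-components, whence `L_2 = 0 ⊕ U ⊕ U ⊕ W₀`, with `U` the space
of edge labels of `L`. The `ω`-orthogonal of this space is `0 ⊕ U^⊥ ⊕ U^⊥ ⊕ W₀`, so that `L` is
Lagrangian exactly when `U^⊥ = U`. On the Courant algebroid side, sections of an isotropic `U × W₀`
have vanishing pairings; comparing them with constant sections, whose brackets vanish, shows that
their brackets take values in `U^⊥`. So `U × W₀` is Dirac under the same condition on `U`.
-/

namespace SimplicialSubspace

variable {V : SimplicialVect.{u}} (L : SimplicialSubspace V)

theorem face_mem {n : ℕ} (i : Fin (n + 2)) {x : V _⦋n + 1⦌} (hx : x ∈ L.obj (n + 1)) :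
    V.face i x ∈ L.obj n :=
  L.map_mem (SimplexCategory.δ i) x hx

theorem degen_mem {n : ℕ} (i : Fin (n + 1)) {x : V _⦋n⦌} (hx : x ∈ L.obj n) :
    V.degen i x ∈ L.obj (n + 1) :=
  L.map_mem (SimplexCategory.σ i) x hx

theorem isSubTwoGroupoid (hV : V.IsTwoGroupoid) : L.IsSubTwoGroupoid where
  finite n := by
    have := hV.finite n
    exact inferInstanceAs (Module.Finite ℝ (L.obj n))
  fill := SimplicialVect.exists_filler
  unique q k y y' hq h := Subtype.ext <|
    hV.unique q k y.1 y'.1 hq fun i hi => congrArg Subtype.val (h i hi)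

theorem exists_mem_face_eq {q : ℕ} (k : Fin (q + 2)) {x : V _⦋q + 1⦌}
    (hx : ∀ i ≠ k, V.face i x ∈ L.obj q) :
    ∃ y ∈ L.obj (q + 1), ∀ i ≠ k, V.face i y = V.face i x := by
  have horn : L.toSimplicialVect.IsHorn q k fun i => ⟨V.face i.1 x, hx i.1 i.2⟩ := by
    rcases q with _ | q
    · trivial
    · exact fun i j _ _ hij => Subtype.ext (SimplicialVect.face_face hij x)
  obtain ⟨y, hy⟩ := SimplicialVect.exists_filler q k _ horn
  exact ⟨y.1, y.2, fun i hi => congrArg Subtype.val (hy ⟨i, hi⟩)⟩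

variable {L}

theorem obj_le_of_obj_two_le (hV : V.IsTwoGroupoid) {L' : SimplicialSubspace V}
    (h : L.obj 2 ≤ L'.obj 2) (n : ℕ) : L.obj n ≤ L'.obj n := by
  have descend : ∀ m, L.obj (m + 1) ≤ L'.obj (m + 1) → L.obj m ≤ L'.obj m := fun m hm x hx => by
    rw [← SimplicialVect.face_degen_castSucc 0 x]
    exact L'.face_mem _ (hm (L.degen_mem 0 hx))
  have ascend : ∀ m, L.obj (m + 2) ≤ L'.obj (m + 2) := fun m => by
    induction m with
    | zero => exact h
    | succ m ih =>
      intro x hx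
      obtain ⟨y, hy, hyx⟩ := L'.exists_mem_face_eq 0 fun i _ => ih (L.face_mem i hx)
      exact hV.unique (m + 2) 0 y x (by omega) hyx ▸ hy
  match n with
  | 0 => exact descend 0 (descend 1 h)
  | 1 => exact descend 1 h
  | m + 2 => exact ascend m

theorem ext_obj_two (hV : V.IsTwoGroupoid) {L' : SimplicialSubspace V}
    (h : L.obj 2 = L'.obj 2) : L = L' :=
  SimplicialSubspace.ext <| funext fun n =>
    (obj_le_of_obj_two_le hV h.le n).antisymm (obj_le_of_obj_two_le hV h.ge n)

theorem isLagrangian_iff {ω : LinearMap.BilinForm ℝ (V _⦋2⦌)} (hω : ω.IsRefl) :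
    L.IsLagrangian ω ↔ ω.orthogonal (L.obj 2) = L.obj 2 := by
  rw [eq_comm, SetLike.ext_iff]
  exact forall_congr' fun x => iff_congr Iff.rfl (forall₂_congr fun y _ => hω.eq_iff)

end SimplicialSubspace

section ThreeTerm

variable {W₀ : Type u} {W₁ : Type v} {W₂ : Type u}
  [AddCommGroup W₀] [Module ℝ W₀] [AddCommGroup W₁] [Module ℝ W₁] [AddCommGroup W₂] [Module ℝ W₂]
  (d₁ : W₁ →ₗ[ℝ] W₀) (d₂ : W₂ →ₗ[ℝ] W₁)

/-- The simplicial subspace of those simplices of the 2-groupoid of `W₂ → W₁ → W₀` whose edges are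
labelled by `U ⊆ W₁` and whose triangles are labelled by `0`. -/
def flatSubspace (U : Submodule ℝ W₁) : SimplicialSubspace (complexSimplicialVect d₁ d₂) where
  obj _ :=
    { carrier := {x | (∀ i j, x.1.2.1 i j ∈ U) ∧ ∀ i j k, x.1.2.2 i j k = 0}
      zero_mem' := ⟨fun _ _ => U.zero_mem, fun _ _ _ => rfl⟩
      add_mem' := fun hx hy => ⟨fun i j => U.add_mem (hx.1 i j) (hy.1 i j),
        fun i j k => (congrArg₂ (· + ·) (hx.2 i j k) (hy.2 i j k)).trans (add_zero 0)⟩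
      smul_mem' := fun r _ hx => ⟨fun i j => U.smul_mem r (hx.1 i j),
        fun i j k => (congrArg (r • ·) (hx.2 i j k)).trans (smul_zero r)⟩ }
  map_mem θ _ hx := ⟨fun i j => hx.1 (θ.toOrderHom i) (θ.toOrderHom j),
    fun i j k => hx.2 (θ.toOrderHom i) (θ.toOrderHom j) (θ.toOrderHom k)⟩

variable {d₁ d₂}

theorem isWide_flatSubspace (U : Submodule ℝ W₁) : (flatSubspace d₁ d₂ U).IsWide := by
  refine Submodule.eq_top_iff'.2 fun (x : simplices d₁ d₂ 0) =>
    ⟨fun (i j : Fin 1) => ?_, fun (i j k : Fin 1) => x.2.2.1 i j k (by omega)⟩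
  rw [x.2.1 i j (by omega)]
  exact U.zero_mem

theorem mem_flatSubspace_one (U : Submodule ℝ W₁) (x : (complexSimplicialVect d₁ d₂) _⦋1⦌) :
    x ∈ (flatSubspace d₁ d₂ U).obj 1 ↔ (edgeEquiv x).1 ∈ U := by
  refine ⟨fun h => h.1 0 1, fun h =>
    ⟨fun (i j : Fin 2) => ?_, fun (i j k : Fin 2) => x.2.2.1 i j k (by decide +revert)⟩⟩
  by_cases hij : i < j
  · obtain ⟨rfl, rfl⟩ : i = 0 ∧ j = 1 := by omega
    exact h
  · rw [x.2.1 i j hij]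
    exact U.zero_mem

theorem mem_flatSubspace_two (hd : d₁ ∘ₗ d₂ = 0) (U : Submodule ℝ W₁)
    (x : (complexSimplicialVect d₁ d₂) _⦋2⦌) :
    x ∈ (flatSubspace d₁ d₂ U).obj 2 ↔
      (triangleEquiv hd x).1 = 0 ∧ (triangleEquiv hd x).2.1 ∈ U ∧
        (triangleEquiv hd x).2.2.1 ∈ U := by
  refine ⟨fun h => ⟨h.2 0 1 2, h.1 1 2, h.1 0 2⟩, fun ⟨h₀₁₂, h₁₂, h₀₂⟩ =>
    ⟨fun (i j : Fin 3) => ?_, fun (i j k : Fin 3) => ?_⟩⟩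
  · have h₀₁ : x.1.2.1 0 1 ∈ U := by
      have cocycle : d₂ (x.1.2.2 0 1 2) = x.1.2.1 1 2 - x.1.2.1 0 2 + x.1.2.1 0 1 :=
        x.2.2.2.2.1 0 1 2 (by decide) (by decide)
      have h : x.1.2.1 1 2 - x.1.2.1 0 2 + x.1.2.1 0 1 ∈ U := by
        rw [← cocycle, show x.1.2.2 0 1 2 = 0 from h₀₁₂, map_zero]
        exact U.zero_mem
      exact (U.add_mem_iff_right (U.sub_mem h₁₂ h₀₂)).1 h
    by_cases hij : i < j
    · obtain ⟨rfl, rfl⟩ | ⟨rfl, rfl⟩ | ⟨rfl, rfl⟩ :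
        (i = 0 ∧ j = 1) ∨ (i = 0 ∧ j = 2) ∨ (i = 1 ∧ j = 2) := by omega
      exacts [h₀₁, h₀₂, h₁₂]
    · rw [x.2.1 i j hij]
      exact U.zero_mem
  · by_cases hijk : i < j ∧ j < k
    · obtain ⟨rfl, rfl, rfl⟩ : i = 0 ∧ j = 1 ∧ k = 2 := by omega
      exact h₀₁₂
    · exact x.2.2.1 i j k hijk

/-- The subspace of `W₁` formed by the labels of the edges of `L`. -/
def edgeLabels (L : SimplicialSubspace (complexSimplicialVect d₁ d₂)) : Submodule ℝ W₁ :=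
  (L.obj 1).map (LinearMap.fst ℝ W₁ W₀ ∘ₗ edgeEquiv.toLinearMap)

theorem edgeLabels_flatSubspace (U : Submodule ℝ W₁) :
    edgeLabels (flatSubspace d₁ d₂ U) = U := by
  ext w
  constructor
  · rintro ⟨x, hx, rfl⟩
    exact (mem_flatSubspace_one U x).1 hx
  · exact fun hw => ⟨edgeEquiv.symm (w, 0), (mem_flatSubspace_one U _).2 hw, rfl⟩

variable {L : SimplicialSubspace (complexSimplicialVect d₁ d₂)}

theorem mem_obj_one_of_mem_edgeLabels (hw : L.IsWide) {x : (complexSimplicialVect d₁ d₂) _⦋1⦌}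
    (hx : (edgeEquiv x).1 ∈ edgeLabels L) : x ∈ L.obj 1 := by
  obtain ⟨(y : (complexSimplicialVect d₁ d₂) _⦋1⦌), hy, hyx⟩ := hx
  have degenerate : SimplicialVect.degen _ 0 (SimplicialVect.face _ 0 (x - y)) = x - y := by
    refine edgeEquiv.injective (Prod.ext ?_ rfl)
    exact ((x - y).prop.1 1 1 (by decide)).trans (sub_eq_zero.2 hyx.symm).symm
  have vertex_mem : SimplicialVect.face _ 0 (x - y) ∈ L.obj 0 := hw ▸ Submodule.mem_top
  rw [← sub_add_cancel x y, ← degenerate]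
  exact (L.obj 1).add_mem (L.degen_mem 0 vertex_mem) hy

theorem flatSubspace_edgeLabels [FiniteDimensional ℝ W₀] [FiniteDimensional ℝ W₁]
    [FiniteDimensional ℝ W₂] (hd : d₁ ∘ₗ d₂ = 0) (hw : L.IsWide)
    (h : ∀ x ∈ L.obj 2, (triangleEquiv hd x).1 = 0) : flatSubspace d₁ d₂ (edgeLabels L) = L := by
  refine SimplicialSubspace.ext_obj_two complexSimplicialVect_isTwoGroupoid
    (Submodule.ext fun x => ?_)
  rw [mem_flatSubspace_two hd]
  constructor
  · rintro ⟨hx, h₁₂, h₀₂⟩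
    have faces_mem : ∀ i ≠ (2 : Fin 3), SimplicialVect.face _ i x ∈ L.obj 1 := fun i hi => by
      obtain rfl | rfl : i = 0 ∨ i = 1 := by omega
      exacts [mem_obj_one_of_mem_edgeLabels hw h₁₂, mem_obj_one_of_mem_edgeLabels hw h₀₂]
    obtain ⟨y, hy, hyx⟩ := L.exists_mem_face_eq 2 faces_mem
    have face_zero := congrArg edgeEquiv (hyx 0 (by decide))
    have face_one := congrArg edgeEquiv (hyx 1 (by decide))
    have : y = x := (triangleEquiv hd).injective <| Prod.ext ((h y hy).trans hx.symm) <|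
      Prod.ext (Prod.ext_iff.1 face_zero).1 <|
        Prod.ext (Prod.ext_iff.1 face_one).1 (Prod.ext_iff.1 face_zero).2
    exact this ▸ hy
  · exact fun hx => ⟨h x hx, ⟨_, L.face_mem 0 hx, rfl⟩, ⟨_, L.face_mem 1 hx, rfl⟩⟩

end ThreeTerm

section Courant

variable {W₀ : Type u} {W₁ : Type v} [NormedAddCommGroup W₀] [NormedSpace ℝ W₀]
  [NormedAddCommGroup W₁] [NormedSpace ℝ W₁]

theorem isSmoothSubbundle_const (U : Submodule ℝ W₁) [FiniteDimensional ℝ U] :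
    IsSmoothSubbundle fun _ : W₀ => U := by
  let b := Module.finBasis ℝ U
  have independent : LinearIndependent ℝ fun i => (b i : W₁) :=
    b.linearIndependent.map' U.subtype U.ker_subtype
  have spanning : Submodule.span ℝ (Set.range fun i => (b i : W₁)) = U := by
    have h := congrArg (Submodule.map U.subtype) b.span_eq
    rwa [Submodule.map_span, Submodule.map_top, Submodule.range_subtype, ← Set.range_comp] at h
  exact fun x => ⟨Set.univ, isOpen_univ, trivial, _, fun i _ => b i,
    fun i => contDiffOn_const, fun y _ => ⟨independent, spanning⟩⟩

namespace ConstantCourantAlgebroid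

variable (E : ConstantCourantAlgebroid W₀ W₁) {U : Submodule ℝ W₁}

theorem fderiv_pairing_eq_zero (hU : U ≤ E.pairing.orthogonal U) {e₁ e₂ : smoothSections W₀ W₁}
    (h₁ : ∀ x, e₁.1 x ∈ U) (h₂ : ∀ x, e₂.1 x ∈ U) (x v : W₀) :
    fderiv ℝ (fun y => E.pairing (e₁.1 y) (e₂.1 y)) x v = 0 := by
  have : (fun y => E.pairing (e₁.1 y) (e₂.1 y)) = fun _ => 0 :=
    funext fun y => hU (h₂ y) _ (h₁ y)
  rw [this, fderiv_fun_const]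
  rfl

theorem pairing_bracket_const (hU : U ≤ E.pairing.orthogonal U) {e : smoothSections W₀ W₁}
    (he : ∀ x, e.1 x ∈ U) (w : W₁) {v : W₁} (hv : v ∈ U) (x : W₀) :
    E.pairing ((E.bracket (smoothSections.const w) e).1 x) v = 0 := by
  have h := E.invariance (smoothSections.const w) e (smoothSections.const v) x
  rw [E.fderiv_pairing_eq_zero hU he fun _ => hv, E.bracket_const] at h
  change 0 = E.pairing _ v + E.pairing _ 0 at h
  rw [map_zero, add_zero] at h
  exact h.symm

theorem bracket_mem_orthogonal (hU : U ≤ E.pairing.orthogonal U) {e₁ e₂ : smoothSections W₀ W₁}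
    (h₁ : ∀ x, e₁.1 x ∈ U) (h₂ : ∀ x, e₂.1 x ∈ U) (x : W₀) :
    (E.bracket e₁ e₂).1 x ∈ E.pairing.orthogonal U := by
  intro u hu
  let c : smoothSections W₀ W₁ := smoothSections.const u
  have hc : ∀ x, c.1 x ∈ U := fun _ => hu
  have bracket_const_right : E.pairing ((E.bracket e₁ c).1 x) (e₂.1 x) = 0 := by
    have h := E.symmetrization e₁ c e₂ x
    rw [E.fderiv_pairing_eq_zero hU h₁ hc] at h
    change E.pairing ((E.bracket e₁ c).1 x + (E.bracket c e₁).1 x) _ = 0 at h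
    rwa [map_add, LinearMap.add_apply, E.pairing_bracket_const hU h₁ u (h₂ x), add_zero] at h
  have h := E.invariance e₁ c e₂ x
  rw [E.fderiv_pairing_eq_zero hU hc h₂, bracket_const_right, zero_add] at h
  exact h.symm

theorem isConstantDirac_iff [FiniteDimensional ℝ U] :
    E.IsConstantDirac U ↔ E.pairing.orthogonal U = U := by
  have orthogonal_iff : E.pairing.orthogonal U = U ↔
      ∀ w, w ∈ U ↔ ∀ u ∈ U, E.pairing u w = 0 := by
    rw [eq_comm, SetLike.ext_iff]
    rfl
  refine ⟨fun h => orthogonal_iff.2 (h.orthogonal 0), fun hU =>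
    ⟨isSmoothSubbundle_const U, fun _ => orthogonal_iff.1 hU, fun e₁ e₂ h₁ h₂ x => ?_⟩⟩
  exact hU.le (E.bracket_mem_orthogonal hU.ge h₁ h₂ x)

end ConstantCourantAlgebroid

end Courant

namespace CourantData

variable {W₀ : Type u} {W₁ : Type v} [AddCommGroup W₀] [Module ℝ W₀]
  [AddCommGroup W₁] [Module ℝ W₁] [FiniteDimensional ℝ W₁] (D : CourantData W₀ W₁)

/-- The sub-2-groupoid `L` with `L_1 = U ⊕ W₀` and `L_2 = 0 ⊕ U ⊕ U ⊕ W₀`, which corresponds to the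
subbundle `U × W₀`. -/
noncomputable def diracGroupoid (U : Submodule ℝ W₁) : SimplicialSubspace D.V :=
  flatSubspace D.bdry D.bdryStar U

theorem mem_diracGroupoid_one (U : Submodule ℝ W₁) (x : D.V _⦋1⦌) :
    x ∈ (D.diracGroupoid U).obj 1 ↔ (D.coord₁ x).1 ∈ U :=
  mem_flatSubspace_one U x

theorem mem_diracGroupoid_two (U : Submodule ℝ W₁) (x : D.V _⦋2⦌) :
    x ∈ (D.diracGroupoid U).obj 2 ↔
      (D.coord₂ x).1 = 0 ∧ (D.coord₂ x).2.1 ∈ U ∧ (D.coord₂ x).2.2.1 ∈ U :=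
  mem_flatSubspace_two D.bdry_comp_bdryStar U x

theorem diracGroupoid_two_injective :
    Function.Injective fun U => (D.diracGroupoid U).obj 2 := by
  intro U U' h
  ext w
  have mem_iff : ∀ U, D.coord₂.symm (0, w, 0, 0) ∈ (D.diracGroupoid U).obj 2 ↔ w ∈ U := by
    intro U
    rw [mem_diracGroupoid_two, LinearEquiv.apply_symm_apply]
    exact ⟨fun h => h.2.1, fun h => ⟨rfl, h, U.zero_mem⟩⟩
  rw [← mem_iff U, ← mem_iff U']
  exact SetLike.ext_iff.1 h _

theorem orthogonal_diracGroupoid_two (U : Submodule ℝ W₁) :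
    D.form.orthogonal ((D.diracGroupoid U).obj 2) =
      (D.diracGroupoid (D.pairing.orthogonal U)).obj 2 := by
  ext x
  rw [mem_diracGroupoid_two]
  constructor
  · intro h
    have form_eq_zero : ∀ u ∈ U, ∀ u' ∈ U, ∀ w₀, D.form (D.coord₂.symm (0, u, u', w₀)) x = 0 :=
      fun u hu u' hu' w₀ => h _ <| (D.mem_diracGroupoid_two U _).2 <| by
        rw [LinearEquiv.apply_symm_apply]
        exact ⟨rfl, hu, hu'⟩
    have triangle : (D.coord₂ x).1 = 0 := LinearMap.ext fun w₀ => by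
      simpa [form_apply] using form_eq_zero 0 U.zero_mem 0 U.zero_mem w₀
    refine ⟨triangle, fun u hu => ?_, fun u hu => ?_⟩
    · simpa [form_apply, triangle] using form_eq_zero 0 U.zero_mem u hu 0
    · simpa [form_apply, triangle] using form_eq_zero u hu 0 U.zero_mem 0
  · rintro ⟨triangle, h₁₂, h₀₂⟩ y hy
    obtain ⟨triangle', h₁₂', h₀₂'⟩ := (D.mem_diracGroupoid_two U y).1 hy
    rw [form_apply, triangle, triangle', h₁₂ _ h₀₂', h₀₂ _ h₁₂']
    simp only [LinearMap.zero_apply, add_zero, sub_zero, mul_zero]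

theorem isLagrangian_diracGroupoid_iff (U : Submodule ℝ W₁) :
    (D.diracGroupoid U).IsLagrangian D.form ↔ D.pairing.orthogonal U = U := by
  rw [SimplicialSubspace.isLagrangian_iff D.form_alt.isRefl, orthogonal_diracGroupoid_two]
  exact D.diracGroupoid_two_injective.eq_iff

variable {D} in
theorem coord₂_fst_eq_zero {L : SimplicialSubspace D.V}
    (hl : L.obj 2 ≤ D.form.orthogonal (L.obj 2)) (hw : L.IsWide) {x : D.V _⦋2⦌}
    (hx : x ∈ L.obj 2) : (D.coord₂ x).1 = 0 := by
  ext w₀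
  have vertex_mem : D.coord₀.symm w₀ ∈ L.obj 0 := hw ▸ Submodule.mem_top
  have h := hl hx _ (L.degen_mem 0 (L.degen_mem 0 vertex_mem))
  rw [← D.coord₀.apply_symm_apply w₀, ← D.pairingA_form]
  exact h

variable {D} in
theorem diracGroupoid_edgeLabels [FiniteDimensional ℝ W₀] {L : SimplicialSubspace D.V}
    (hl : L.IsLagrangian D.form) (hw : L.IsWide) : D.diracGroupoid (edgeLabels L) = L :=
  flatSubspace_edgeLabels D.bdry_comp_bdryStar hw fun _ =>
    coord₂_fst_eq_zero ((SimplicialSubspace.isLagrangian_iff D.form_alt.isRefl).1 hl).ge hw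

/-- Self-orthogonal subspaces of `W₁` correspond to wide linear Lagrangian sub-2-groupoids. -/
noncomputable def lagrangianEquiv [FiniteDimensional ℝ W₀] :
    {U : Submodule ℝ W₁ // D.pairing.orthogonal U = U} ≃
      {L : SimplicialSubspace D.V // L.IsSubTwoGroupoid ∧ L.IsLagrangian D.form ∧ L.IsWide} where
  toFun U := ⟨D.diracGroupoid U.1,
    SimplicialSubspace.isSubTwoGroupoid _ D.symplecticTwoGroupoid.isTwoGroupoid,
    (D.isLagrangian_diracGroupoid_iff U.1).2 U.2, isWide_flatSubspace U.1⟩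
  invFun L := ⟨edgeLabels L.1, (D.isLagrangian_diracGroupoid_iff _).1 <|
    (diracGroupoid_edgeLabels L.2.2.1 L.2.2.2).symm ▸ L.2.2.1⟩
  left_inv U := Subtype.ext (edgeLabels_flatSubspace U.1)
  right_inv L := Subtype.ext (diracGroupoid_edgeLabels L.2.2.1 L.2.2.2)

end CourantData

theorem theorem5p6 {W₀ : Type u} {W₁ : Type v}
    [NormedAddCommGroup W₀] [NormedSpace ℝ W₀] [FiniteDimensional ℝ W₀]
    [NormedAddCommGroup W₁] [NormedSpace ℝ W₁] [FiniteDimensional ℝ W₁]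
    (D : CourantData W₀ W₁) :
    ∃ Φ : {U : Submodule ℝ W₁ // D.courantAlgebroid.IsConstantDirac U} ≃
        {L : SimplicialSubspace D.symplecticTwoGroupoid.V //
          L.IsSubTwoGroupoid ∧ L.IsLagrangian D.symplecticTwoGroupoid.ω ∧ L.IsWide},
      ∀ U : {U : Submodule ℝ W₁ // D.courantAlgebroid.IsConstantDirac U},
        (∀ x : D.V _⦋1⦌, x ∈ (Φ U).1.obj 1 ↔ (D.coord₁ x).1 ∈ U.1) ∧
        (∀ x : D.V _⦋2⦌, x ∈ (Φ U).1.obj 2 ↔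
          (D.coord₂ x).1 = 0 ∧ (D.coord₂ x).2.1 ∈ U.1 ∧ (D.coord₂ x).2.2.1 ∈ U.1) :=
  ⟨(Equiv.subtypeEquivRight fun _ => D.courantAlgebroid.isConstantDirac_iff).trans
      D.lagrangianEquiv,
    fun U => ⟨D.mem_diracGroupoid_one U.1, D.mem_diracGroupoid_two U.1⟩⟩
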